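/- For a finite simple graph $G$ and an integer $t\ge 1$, let $\mathrm{mcc}_t(G)$ be the smallest integer $m$ such that the vertices of $G$ can be colored with $t$ colors so that no monochromatic connected component (i.e. no connected component of a subgraph induced by a color class) has more than $m$ vertices. Then for every real $\varepsilon>0$ there exists a constant $c_\varepsilon>0$ such that there are finite simple graphs $G$ with arbitrarily large number $n$ of vertices for which all of the following hold: 1. every vertex of $G$ has degree at most $7$; 2. every subgraph of $G$ with at least one vertex (not necessarily induced) has average degree at most $6+\varepsilon$; 3. $\mathrm{mcc}_2(G)\ge c_\varepsilon n$. -/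

import Mathlib

namespace MonoComp

/-- Every connected component of the subgraph of `G` induced by a colour class of `c`
has at most `m` vertices. -/
def MonoComponentsLE {V : Type*} {t : ℕ} (G : SimpleGraph V) (c : V → Fin t) (m : ℕ) : Prop :=
  ∀ (i : Fin t) (K : (G.induce {v | c v = i}).ConnectedComponent), Nat.card K.supp ≤ m

/-- `mcc t G` (for a finite graph `G`): the smallest `m` such that the vertices of `G` can be
coloured with `t` colours so that no monochromatic connected component has more than `m`
vertices. -/
noncomputable def mcc {V : Type*} (t : ℕ) (G : SimpleGraph V) : ℕ :=
  sInf {m : ℕ | ∃ c : V → Fin t, MonoComponentsLE G c m}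

/-- For a finite graph and at least one colour the minimum defining `mcc` is attained. -/
theorem exists_coloring_mcc {V : Type*} [Finite V] (t : ℕ) (ht : 0 < t) (G : SimpleGraph V) :
    ∃ c : V → Fin t, MonoComponentsLE G c (mcc t G) := by
  have hne : {m : ℕ | ∃ c : V → Fin t, MonoComponentsLE G c m}.Nonempty := by
    refine ⟨Nat.card V, fun _ => ⟨0, ht⟩, fun i K => ?_⟩
    exact (Finite.card_subtype_le _).trans (Finite.card_subtype_le _)
  exact Nat.sInf_mem hne

/-- The average degree of a finite graph: the sum of all vertex degrees divided by the number
of vertices (and `0` for the graph without vertices). -/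
noncomputable def averageDegree {V : Type*} (G : SimpleGraph V) : ℝ :=
  (∑ᶠ v : V, ((G.neighborSet v).ncard : ℝ)) / (Nat.card V : ℝ)

end MonoComp

namespace MonoComp

open Finset

/-! ### Counting permutations with many pairs inside a small set. -/

section RandomPermutation

variable {α : Type*} [Fintype α] [DecidableEq α]

/-! The graph is the line graph of a multigraph: `m` copies of a tree block, joined by a random
matching of stubs. In a block a root has four centres below it, and each centre starts two arms,
paths on `T + 1` vertices. With stubs included, centres have degree at most 5 and all other vertices
at most 4. No edge joins two centres, so line graph degrees are at most 5 + 4 - 2 = 7.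

Average degree: only a centre of full degree 5 can push a subgraph above 6, and its two long arms
absorb the surplus (`sum_excess_halfDegree_nonpos`).

Large components: put `h = 8(T+1)+6`; a block has `h - 1` vertices and accounts for `2h` edges. A
small edge set has at most `1 + 1/h` times as many edges as endpoints (`mul_card_le_of_sparse`),
because its tree edges form a forest and a random matching places few edges inside few blocks
(`exists_perm_sparse`). Monochromatic components of one colour have disjoint endpoint sets, so if
all are small, two colours cover at most `2(1 + 1/h)(h - 1) < 2h` edges per block, a contradiction.
-/

theorem card_perm_eqOn_le (A : Finset α) (f : A → α) :
    #{π : Equiv.Perm α | ∀ x : A, π x = f x} ≤ (Fintype.card α - #A).factorial := by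
  classical
  rcases Finset.eq_empty_or_nonempty ({π : Equiv.Perm α | ∀ x : A, π x = f x} : Finset _)
    with h | ⟨π₀, h₀⟩
  · rw [h]; exact Nat.zero_le _
  have h₀' : ∀ x : A, π₀ x = f x := by simpa using h₀
  have hcard : Fintype.card {g : Equiv.Perm α // ∀ x, ¬ (x ∉ A) → g x = x}
      = (Fintype.card α - #A).factorial := by
    rw [← Fintype.card_congr (Equiv.Perm.subtypeEquivSubtypePerm (fun x => x ∉ A)),
      Fintype.card_perm, Fintype.card_subtype_compl]
    simp
  rw [← hcard, ← Finset.card_univ]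
  refine Finset.card_le_card_of_surjOn (fun g => π₀ * g.1) ?_
  intro π hπ
  have hπ' : ∀ x : A, π x = f x := by simpa using hπ
  refine ⟨⟨π₀⁻¹ * π, fun x hx => ?_⟩, by simp, by simp⟩
  have hx' : x ∈ A := by simpa using hx
  have h1 := hπ' ⟨x, hx'⟩
  have h2 := h₀' ⟨x, hx'⟩
  simp only at h1 h2
  rw [Equiv.Perm.mul_apply, h1, ← h2]
  exact π₀.symm_apply_apply x

theorem card_perm_mapsTo_le (A Z : Finset α) :
    #{π : Equiv.Perm α | ∀ x ∈ A, π x ∈ Z} ≤ #Z ^ #A * (Fintype.card α - #A).factorial := by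
  classical
  have hsub : ({π : Equiv.Perm α | ∀ x ∈ A, π x ∈ Z} : Finset _) ⊆
      (Fintype.piFinset (fun _ : A => Z)).biUnion
        (fun f => {π : Equiv.Perm α | ∀ x : A, π x = f x}) := by
    intro π hπ
    simp only [mem_filter, mem_univ, true_and] at hπ
    simp only [mem_biUnion, Fintype.mem_piFinset, mem_filter, mem_univ, true_and]
    exact ⟨fun x => π x, fun x => hπ x x.2, fun x => rfl⟩
  refine (card_le_card hsub).trans ?_
  refine (card_biUnion_le_card_mul _ _ _ fun f _ => card_perm_eqOn_le A f).trans ?_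
  simp

/-- Union bound over the `q`-subsets of `Z` sent into `Z`; their number is bounded crudely by the
number of all subsets. -/
theorem card_perm_many_internal_le (Z : Finset α) (q : ℕ) :
    #{π : Equiv.Perm α | q ≤ #{x ∈ Z | π x ∈ Z}}
      ≤ 2 ^ #Z * (#Z ^ q * (Fintype.card α - q).factorial) := by
  classical
  have hsub : ({π : Equiv.Perm α | q ≤ #{x ∈ Z | π x ∈ Z}} : Finset _) ⊆
      (Z.powersetCard q).biUnion (fun A => {π : Equiv.Perm α | ∀ x ∈ A, π x ∈ Z}) := by
    intro π hπ
    simp only [mem_filter, mem_univ, true_and] at hπ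
    obtain ⟨A, hA, hAc⟩ := exists_subset_card_eq hπ
    simp only [mem_biUnion, mem_powersetCard, mem_filter, mem_univ, true_and]
    exact ⟨A, ⟨hA.trans (filter_subset _ _), hAc⟩, fun x hx => (mem_filter.1 (hA hx)).2⟩
  refine (card_le_card hsub).trans ?_
  refine (card_biUnion_le_card_mul _ _ (#Z ^ q * (Fintype.card α - q).factorial) ?_).trans ?_
  · intro A hA
    have := card_perm_mapsTo_le A Z
    rwa [(mem_powersetCard.1 hA).2] at this
  · refine Nat.mul_le_mul_right _ ?_
    rw [card_powersetCard]
    exact Nat.choose_le_two_pow _ _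

end RandomPermutation

theorem factorial_sub_mul_pow_le {M q : ℕ} (h : 2 * q ≤ M) :
    ((M - q).factorial : ℝ) * ((M : ℝ) / 2) ^ q ≤ M.factorial := by
  have h1 : (M - q).factorial * M.descFactorial q = M.factorial :=
    Nat.factorial_mul_descFactorial (by omega)
  have h2 := Nat.pow_sub_le_descFactorial M q
  have h3 : ((M : ℝ) / 2) ^ q ≤ (M.descFactorial q : ℝ) := by
    refine le_trans ?_ (Nat.cast_le.2 h2)
    push_cast
    refine pow_le_pow_left₀ (by positivity) ?_ _
    rw [Nat.cast_sub (by omega)]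
    have : (2 * q : ℝ) ≤ M := by exact_mod_cast h
    push_cast
    linarith
  calc ((M - q).factorial : ℝ) * ((M : ℝ) / 2) ^ q
      ≤ (M - q).factorial * M.descFactorial q := by gcongr
    _ = M.factorial := by exact_mod_cast h1

theorem sum_half_pow_Icc_lt (n : ℕ) : ∑ k ∈ Icc 1 n, (1 / 2 : ℝ) ^ k < 1 := by
  have : ∑ k ∈ Icc 1 n, (1 / 2 : ℝ) ^ k = 1 - (1 / 2) ^ n := by
    induction n with
    | zero => simp
    | succ n ih => rw [sum_Icc_succ_top (by omega), ih, pow_succ]; ring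
  rw [this]
  have : (0 : ℝ) < (1 / 2) ^ n := by positivity
  linarith

/-- Of the `q` factors `2k/m`, the first `k` cancel the `m ^ k` of the binomial coefficient. The
other `q - k ≥ k/h` are each at most `θ ^ h`, giving `θ ^ k`, which beats the remaining exponential
factors. -/
theorem choose_mul_two_pow_mul_pow_le {d h m k q : ℕ} {θ : ℝ} (hθ : 0 < θ)
    (hθd : θ * (6 * 2 ^ d) ≤ 1 / 2) (hk : 0 < k) (hm : 0 < m)
    (hq : k ≤ h * (q - k)) (hkq : k ≤ q) (hkm : 2 * (k : ℝ) / m ≤ θ ^ h) :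
    (m.choose k : ℝ) * (2 ^ (d * k) * (2 * k / m) ^ q) ≤ (1 / 2) ^ k := by
  have hm' : (0 : ℝ) < m := by exact_mod_cast hm
  have hθ1 : θ ≤ 1 := by
    have : (1 : ℝ) ≤ 2 ^ d := one_le_pow₀ (by norm_num)
    nlinarith
  have h1 : (m.choose k : ℝ) ≤ (m : ℝ) ^ k / k.factorial := Nat.choose_le_pow_div k m
  have h2 : (k : ℝ) ^ k / k.factorial ≤ 3 ^ k := by
    refine (Real.pow_div_factorial_le_exp (k : ℝ) (by positivity) k).trans ?_
    rw [← Real.exp_one_pow]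
    exact pow_le_pow_left₀ (Real.exp_pos _).le (Real.exp_one_lt_d9.le.trans (by norm_num)) _
  have h3 : (2 * (k : ℝ) / m) ^ (q - k) ≤ θ ^ k := by
    refine (pow_le_pow_left₀ (by positivity) hkm _).trans ?_
    rw [← pow_mul]
    exact pow_le_pow_of_le_one hθ.le hθ1 hq
  have h4 : (2 * (k : ℝ) / m) ^ q = (2 * (k : ℝ) / m) ^ k * (2 * (k : ℝ) / m) ^ (q - k) := by
    rw [← pow_add]; congr 1; omega
  rw [h4]
  calc (m.choose k : ℝ) * (2 ^ (d * k) * ((2 * (k : ℝ) / m) ^ k * (2 * (k : ℝ) / m) ^ (q - k)))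
      ≤ ((m : ℝ) ^ k / k.factorial) * (2 ^ (d * k) * ((2 * (k : ℝ) / m) ^ k * θ ^ k)) := by
        gcongr
    _ = ((k : ℝ) ^ k / k.factorial) * (2 ^ d) ^ k * 2 ^ k * θ ^ k := by
        rw [div_pow, mul_pow, pow_mul]; field_simp
    _ ≤ 3 ^ k * (2 ^ d) ^ k * 2 ^ k * θ ^ k := by gcongr
    _ = (θ * (6 * 2 ^ d)) ^ k := by
        rw [show θ * (6 * 2 ^ d) = 3 * 2 ^ d * 2 * θ by ring]; simp only [mul_pow]
    _ ≤ (1 / 2) ^ k := pow_le_pow_left₀ (by positivity) hθd _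

/-- In a random permutation of `Fin m × D`, small sets of blocks span few internal pairs. -/
theorem exists_perm_sparse (D : Type*) [Fintype D] [DecidableEq D] [Nonempty D] (h : ℕ)
    (hh : 0 < h) :
    ∃ c : ℝ, 0 < c ∧ ∀ m : ℕ, 0 < m → ∃ π : Equiv.Perm (Fin m × D),
      ∀ I : Finset (Fin m), (#I : ℝ) ≤ c * m →
        h * #{e : Fin m × D | e.1 ∈ I ∧ (π e).1 ∈ I} ≤ (h + 1) * #I := by
  classical
  set d := Fintype.card D with hd
  have hd0 : 0 < d := Fintype.card_pos
  set θ : ℝ := 1 / (12 * 2 ^ d) with hθ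
  have hθ0 : 0 < θ := by positivity
  have hθd : θ * (6 * 2 ^ d) ≤ 1 / 2 := by rw [hθ]; field_simp; norm_num
  have hθ12 : θ ≤ 1 / 12 := by
    rw [hθ]
    refine one_div_le_one_div_of_le (by norm_num) ?_
    have : (1 : ℝ) ≤ 2 ^ d := one_le_pow₀ (by norm_num)
    linarith
  have hθh : θ ^ h ≤ 1 / 12 :=
    (pow_le_of_le_one hθ0.le (by linarith) hh.ne').trans hθ12
  refine ⟨θ ^ h / 2, by positivity, fun m hm => ?_⟩
  have hm' : (0 : ℝ) < m := by exact_mod_cast hm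
  -- The least integer exceeding `(h + 1) * k / h`, so a set of `k` blocks is bad exactly when it
  -- spans at least `q k` pairs.
  set q : ℕ → ℕ := fun k => (h + 1) * k / h + 1 with hq
  have hqlt : ∀ k, (h + 1) * k < h * q k := fun k => by
    have := Nat.lt_mul_div_succ ((h + 1) * k) hh
    simpa [hq] using this
  have hqle : ∀ k, q k ≤ 2 * k + 1 := fun k => by
    have : (h + 1) * k / h ≤ 2 * k := by
      apply Nat.div_le_of_le_mul
      nlinarith
    simp only [hq]; omega
  have hkq : ∀ k, k ≤ q k := fun k => by
    by_contra! hcon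
    have h1 := hqlt k
    have : h * q k ≤ h * k := Nat.mul_le_mul_left _ hcon.le
    nlinarith
  set bad : Finset (Fin m) → Finset (Equiv.Perm (Fin m × D)) := fun I =>
    {π | q #I ≤ #{x ∈ I ×ˢ (univ : Finset D) | π x ∈ I ×ˢ (univ : Finset D)}} with hbad
  set small : Finset ℕ := {k ∈ Icc 1 m | (k : ℝ) ≤ θ ^ h / 2 * m} with hsmall
  have key : ∀ k ∈ small, ∀ I : Finset (Fin m), #I = k →
      (#(bad I) : ℝ) ≤ (2 ^ (d * k) * (2 * k / m) ^ q k) * (Fintype.card (Fin m × D)).factorial := by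
    intro k hk I hI
    simp only [hsmall, mem_filter, mem_Icc] at hk
    obtain ⟨⟨hk1, hkm⟩, hkc⟩ := hk
    have hkm6 : 6 * k ≤ m := by
      have : (6 * k : ℝ) ≤ m := by nlinarith
      exact_mod_cast this
    have hM : Fintype.card (Fin m × D) = m * d := by simp [hd]
    have hZ : #(I ×ˢ (univ : Finset D)) = d * k := by
      rw [card_product, hI, card_univ, mul_comm]
    have h1 := card_perm_many_internal_le (I ×ˢ (univ : Finset D)) (q k)
    rw [hZ, hM] at h1
    have h2 : 2 * q k ≤ m * d := by
      have := hqle k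
      have : m * 1 ≤ m * d := Nat.mul_le_mul_left _ hd0
      omega
    have h3 := factorial_sub_mul_pow_le h2
    have h4 : (#(bad I) : ℝ) ≤
        (2 : ℝ) ^ (d * k) * ((d * k : ℝ) ^ q k * ((m * d - q k).factorial : ℝ)) := by
      have : #(bad I) ≤ 2 ^ (d * k) * ((d * k) ^ q k * (m * d - q k).factorial) := by
        simpa only [hbad, hI] using h1
      exact_mod_cast this
    refine h4.trans ?_
    rw [hM, mul_assoc]
    refine mul_le_mul_of_nonneg_left ?_ (by positivity)
    have hd' : (0 : ℝ) < d := by exact_mod_cast hd0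
    have h5 : (d * k : ℝ) ^ q k = (2 * k / m : ℝ) ^ q k * (((m * d : ℕ) : ℝ) / 2) ^ q k := by
      rw [← mul_pow]; congr 1; push_cast; field_simp
    rw [h5, mul_assoc]
    refine mul_le_mul_of_nonneg_left ?_ (by positivity)
    rw [mul_comm]; exact h3
  set Bad : Finset (Equiv.Perm (Fin m × D)) :=
    small.biUnion fun k => (powersetCard k (univ : Finset (Fin m))).biUnion bad with hBad
  have hlt : (#Bad : ℝ) < (Fintype.card (Fin m × D)).factorial := by
    calc (#Bad : ℝ) ≤ ∑ k ∈ small, ∑ I ∈ powersetCard k (univ : Finset (Fin m)), (#(bad I) : ℝ) := by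
          rw [hBad]
          have : #(small.biUnion fun k => (powersetCard k (univ : Finset (Fin m))).biUnion bad)
              ≤ ∑ k ∈ small, ∑ I ∈ powersetCard k (univ : Finset (Fin m)), #(bad I) :=
            card_biUnion_le.trans (sum_le_sum fun k _ => card_biUnion_le)
          exact_mod_cast this
      _ ≤ ∑ k ∈ small, (1 / 2 : ℝ) ^ k * (Fintype.card (Fin m × D)).factorial := by
          refine sum_le_sum fun k hk => ?_
          refine (sum_le_sum fun I hI => key k hk I (mem_powersetCard.1 hI).2).trans ?_
          rw [sum_const, card_powersetCard, card_univ, Fintype.card_fin, nsmul_eq_mul, ← mul_assoc]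
          refine mul_le_mul_of_nonneg_right ?_ (by positivity)
          simp only [hsmall, mem_filter, mem_Icc] at hk
          refine choose_mul_two_pow_mul_pow_le (h := h) hθ0 hθd (by omega) hm ?_ (hkq k) ?_
          · have h1 := hqlt k
            have h2 := hkq k
            rw [Nat.mul_sub]
            have : (h + 1) * k = h * k + k := by ring
            omega
          · rw [div_le_iff₀ hm']; linarith
      _ ≤ ∑ k ∈ Icc 1 m, (1 / 2 : ℝ) ^ k * (Fintype.card (Fin m × D)).factorial :=
          sum_le_sum_of_subset_of_nonneg (filter_subset _ _) fun _ _ _ => by positivity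
      _ < 1 * (Fintype.card (Fin m × D)).factorial := by
          rw [← sum_mul]
          exact mul_lt_mul_of_pos_right (sum_half_pow_Icc_lt m)
            (by exact_mod_cast Nat.factorial_pos _)
      _ = _ := one_mul _
  have hex : ∃ π, π ∉ Bad := by
    by_contra! hcon
    have : Bad = univ := eq_univ_iff_forall.2 hcon
    rw [this, card_univ, Fintype.card_perm] at hlt
    exact lt_irrefl _ hlt
  obtain ⟨π, hπ⟩ := hex
  refine ⟨π, fun I hI => ?_⟩
  rcases I.eq_empty_or_nonempty with rfl | hne
  · simp
  have hIm : #I ≤ m := by simpa using card_le_univ I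
  by_contra! hcon
  refine hπ ?_
  simp only [hBad, mem_biUnion, mem_powersetCard, hsmall, mem_filter, mem_Icc]
  refine ⟨#I, ⟨⟨hne.card_pos, hIm⟩, hI⟩, I, ⟨subset_univ _, rfl⟩, ?_⟩
  simp only [hbad, mem_filter, mem_univ, true_and]
  have heq : ({x ∈ I ×ˢ (univ : Finset D) | π x ∈ I ×ˢ (univ : Finset D)} : Finset (Fin m × D))
      = ({e : Fin m × D | e.1 ∈ I ∧ (π e).1 ∈ I} : Finset (Fin m × D)) := by
    ext x; simp
  rw [heq, hq]
  exact Nat.succ_le_of_lt (Nat.div_lt_of_lt_mul hcon)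

/-! ### Line graphs of multigraphs: degrees, average degree, colour classes. -/

section LineGraph

variable {V E : Type*}

/-- The line graph of the multigraph with edge set `E` whose edge `e` joins `a e` and `b e`. -/
def lineGraphOf (a b : E → V) : SimpleGraph E where
  Adj e f := e ≠ f ∧ (a e = a f ∨ a e = b f ∨ b e = a f ∨ b e = b f)
  symm := ⟨by rintro e f ⟨h, h'⟩; exact ⟨h.symm, by tauto⟩⟩
  loopless := ⟨fun e h => h.1 rfl⟩

theorem lineGraphOf_adj {a b : E → V} {e f : E} : (lineGraphOf a b).Adj e f ↔
    e ≠ f ∧ (a e = a f ∨ a e = b f ∨ b e = a f ∨ b e = b f) := Iff.rfl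

variable [DecidableEq V]

/-- The degree of `v` in the multigraph with edge set `F`; loops count twice. -/
def halfDegree (a b : E → V) (F : Finset E) (v : V) : ℕ :=
  #{e ∈ F | a e = v} + #{e ∈ F | b e = v}

/-- The set of endpoints of edges in `F`. -/
def endpoints (a b : E → V) (F : Finset E) : Finset V := F.image a ∪ F.image b

theorem sum_halfDegree [Fintype V] (a b : E → V) (F : Finset E) :
    ∑ v, halfDegree a b F v = 2 * #F := by
  simp only [halfDegree, sum_add_distrib]
  rw [← card_eq_sum_card_fiberwise (fun _ _ => mem_univ _),
    ← card_eq_sum_card_fiberwise (fun _ _ => mem_univ _)]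
  ring

theorem sum_halfDegree_endpoints [Fintype V] (a b : E → V) (F : Finset E) :
    ∑ e ∈ F, (halfDegree a b F (a e) + halfDegree a b F (b e))
      = ∑ v, halfDegree a b F v ^ 2 := by
  have key : ∀ g : E → V, ∑ e ∈ F, halfDegree a b F (g e)
      = ∑ v, #{e ∈ F | g e = v} * halfDegree a b F v := by
    intro g
    rw [← sum_fiberwise_of_maps_to (t := univ) (g := g) (fun _ _ => mem_univ _)]
    refine sum_congr rfl fun v _ => ?_
    rw [sum_congr rfl (g := fun _ => halfDegree a b F v), sum_const, smul_eq_mul]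
    intro e he
    rw [(mem_filter.1 he).2]
  rw [sum_add_distrib, key, key, ← sum_add_distrib]
  refine sum_congr rfl fun v _ => ?_
  rw [← add_mul, sq]
  rfl

variable [DecidableEq E]

theorem card_incident_add_one_le (a b : E → V) {F : Finset E} {e : E} (he : e ∈ F) {v : V}
    (hv : a e = v ∨ b e = v) :
    #{f ∈ F | f ≠ e ∧ (a f = v ∨ b f = v)} + 1 ≤ halfDegree a b F v := by
  have h1 : ({f ∈ F | f ≠ e ∧ (a f = v ∨ b f = v)} : Finset E)
      = ({f ∈ F | a f = v} ∪ {f ∈ F | b f = v}).erase e := by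
    ext f; simp only [mem_filter, mem_erase, mem_union]; tauto
  have h2 : e ∈ ({f ∈ F | a f = v} ∪ {f ∈ F | b f = v} : Finset E) := by
    simp only [mem_filter, mem_union]; tauto
  rw [h1, card_erase_add_one h2]
  exact card_union_le _ _

theorem card_adj_add_two_le (a b : E → V) [DecidableRel (lineGraphOf a b).Adj] {F : Finset E}
    {e : E} (he : e ∈ F) :
    #{f ∈ F | (lineGraphOf a b).Adj e f} + 2
      ≤ halfDegree a b F (a e) + halfDegree a b F (b e) := by
  have h1 := card_incident_add_one_le a b he (v := a e) (Or.inl rfl)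
  have h2 := card_incident_add_one_le a b he (v := b e) (Or.inr rfl)
  have h3 : ({f ∈ F | (lineGraphOf a b).Adj e f} : Finset E) ⊆
      {f ∈ F | f ≠ e ∧ (a f = a e ∨ b f = a e)} ∪ {f ∈ F | f ≠ e ∧ (a f = b e ∨ b f = b e)} := by
    intro f hf
    simp only [mem_filter, mem_union, lineGraphOf_adj] at hf ⊢
    obtain ⟨hf, hne, h⟩ := hf
    have := hne.symm
    rcases h with h | h | h | h <;> have := h.symm <;> tauto
  have h4 := (card_le_card h3).trans (card_union_le _ _)
  omega

theorem degree_lineGraphOf_add_two_le [Fintype E] (a b : E → V)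
    [DecidableRel (lineGraphOf a b).Adj] (e : E) :
    (lineGraphOf a b).degree e + 2
      ≤ halfDegree a b univ (a e) + halfDegree a b univ (b e) := by
  have := card_adj_add_two_le a b (mem_univ e)
  rwa [← SimpleGraph.neighborFinset_eq_filter, SimpleGraph.card_neighborFinset_eq_degree] at this

/-- For an edge set `F` with multigraph degrees `d`, the line graph degrees sum to at most `∑ d² -
2#F`, while `∑ d = 2#F`. The bound `2r` on the average thus becomes a condition summed over
vertices. -/
theorem averageDegree_le_of_sum_halfDegree_le [Fintype V] [Fintype E] (a b : E → V) {r : ℝ}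
    (hr : 0 ≤ r) (H : (lineGraphOf a b).Subgraph)
    (hF : ∀ F : Finset E, ∑ v, ((halfDegree a b F v : ℝ) * (halfDegree a b F v - 1)
      - r * halfDegree a b F v) ≤ 0) :
    averageDegree H.coe ≤ 2 * r := by
  classical
  set F : Finset E := H.verts.toFinset with hFdef
  have hcard : Nat.card H.verts = #F := by
    rw [Nat.card_eq_fintype_card, hFdef, Set.toFinset_card]
  have hdeg : ∀ v : H.verts, (H.coe.neighborSet v).ncard
      ≤ #{f ∈ F | (lineGraphOf a b).Adj v f} := by
    intro v
    rw [← Set.ncard_coe_finset]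
    refine Set.ncard_le_ncard_of_injOn Subtype.val ?_ Subtype.val_injective.injOn
      (Set.toFinite _)
    intro f hf
    simp only [coe_filter, Set.mem_ofPred_eq, hFdef, Set.mem_toFinset]
    exact ⟨f.2, H.adj_sub hf⟩
  have hsum : (∑ᶠ v : H.verts, ((H.coe.neighborSet v).ncard : ℝ))
      ≤ ((∑ e ∈ F, #{f ∈ F | (lineGraphOf a b).Adj e f} : ℕ) : ℝ) := by
    rw [finsum_eq_sum_of_fintype]
    have h1 : ∑ v : H.verts, (H.coe.neighborSet v).ncard
        ≤ ∑ v : H.verts, #{f ∈ F | (lineGraphOf a b).Adj v f} :=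
      sum_le_sum fun v _ => hdeg v
    have h2 : ∑ v : H.verts, #{f ∈ F | (lineGraphOf a b).Adj v f}
        = ∑ e ∈ F, #{f ∈ F | (lineGraphOf a b).Adj e f} := by
      rw [sum_subtype F (p := (· ∈ H.verts)) (fun x => by simp [hFdef])]
    rw [h2] at h1
    exact_mod_cast h1
  have hsq : (∑ e ∈ F, #{f ∈ F | (lineGraphOf a b).Adj e f}) + 2 * #F
      ≤ ∑ v, halfDegree a b F v ^ 2 := by
    rw [← sum_halfDegree_endpoints, mul_comm, ← smul_eq_mul, ← sum_const, ← sum_add_distrib]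
    exact sum_le_sum fun e he => card_adj_add_two_le a b he
  have hF' := hF F
  have hlin : ((∑ v, halfDegree a b F v : ℕ) : ℝ) = 2 * #F := by
    rw [sum_halfDegree]; push_cast; ring
  have hsq' : ((∑ e ∈ F, #{f ∈ F | (lineGraphOf a b).Adj e f} : ℕ) : ℝ) + 2 * #F
      ≤ ∑ v, (halfDegree a b F v : ℝ) ^ 2 := by exact_mod_cast hsq
  have hexp : ∑ v, ((halfDegree a b F v : ℝ) * (halfDegree a b F v - 1)
      - r * halfDegree a b F v) = ∑ v, (halfDegree a b F v : ℝ) ^ 2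
        - (1 + r) * ((∑ v, halfDegree a b F v : ℕ) : ℝ) := by
    push_cast
    rw [mul_sum, ← sum_sub_distrib]
    exact sum_congr rfl fun v _ => by ring
  rw [hexp, hlin] at hF'
  rw [averageDegree, hcard]
  refine div_le_of_le_mul₀ (by positivity) (by positivity) ?_
  refine hsum.trans ?_
  nlinarith

/-- Two edges of the same colour sharing an endpoint lie in one component, so the components have
disjoint endpoint sets and their bounds add up. -/
theorem mul_card_colorClass_le [Fintype V] [Fintype E] (a b : E → V) {t : ℕ} (c : E → Fin t)
    {s h : ℕ} (hc : MonoComponentsLE (lineGraphOf a b) c s)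
    (hF : ∀ F : Finset E, #F ≤ s → h * #F ≤ (h + 1) * #(endpoints a b F)) (i : Fin t) :
    h * #{e | c e = i} ≤ (h + 1) * Fintype.card V := by
  classical
  set S : Set E := {v | c v = i} with hS
  let G := (lineGraphOf a b).induce S
  let comp : G.ConnectedComponent → Finset E := fun K => K.supp.toFinset.map ⟨_, Subtype.val_injective⟩
  have hmem : ∀ K e, e ∈ comp K ↔ ∃ he : e ∈ S, G.connectedComponentMk ⟨e, he⟩ = K := by
    intro K e
    simp [comp]
  have hcomp : ∀ K, #(comp K) ≤ s := by
    intro K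
    have := hc i K
    rw [Nat.card_eq_fintype_card] at this
    simp only [comp, card_map, Set.toFinset_card]
    exact this
  have hunion : ({e | c e = i} : Finset E) = univ.biUnion comp := by
    ext e
    simp [hmem, hS]
  have hdisj : (Set.univ : Set G.ConnectedComponent).PairwiseDisjoint
      (fun K => endpoints a b (comp K)) := by
    intro K _ K' _ hne
    refine Finset.disjoint_left.2 fun v hv hv' => hne ?_
    simp only [endpoints, mem_union, mem_image] at hv hv'
    obtain ⟨e, heK, he⟩ : ∃ e ∈ comp K, a e = v ∨ b e = v := by
      rcases hv with ⟨e, h1, h2⟩ | ⟨e, h1, h2⟩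
      exacts [⟨e, h1, Or.inl h2⟩, ⟨e, h1, Or.inr h2⟩]
    obtain ⟨f, hfK, hf⟩ : ∃ e ∈ comp K', a e = v ∨ b e = v := by
      rcases hv' with ⟨e, h1, h2⟩ | ⟨e, h1, h2⟩
      exacts [⟨e, h1, Or.inl h2⟩, ⟨e, h1, Or.inr h2⟩]
    obtain ⟨heS, rfl⟩ := (hmem _ _).1 heK
    obtain ⟨hfS, rfl⟩ := (hmem _ _).1 hfK
    by_cases hef : e = f
    · subst hef; rfl
    · refine SimpleGraph.ConnectedComponent.connectedComponentMk_eq_of_adj ?_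
      refine (SimpleGraph.comap_adj).2 ⟨hef, ?_⟩
      rcases he with he | he <;> rcases hf with hf | hf <;> simp [he, hf]
  calc h * #{e | c e = i} ≤ h * ∑ K, #(comp K) := by
        rw [hunion]; exact Nat.mul_le_mul_left _ card_biUnion_le
    _ ≤ ∑ K, (h + 1) * #(endpoints a b (comp K)) := by
        rw [mul_sum]; exact sum_le_sum fun K _ => hF _ (hcomp K)
    _ = (h + 1) * #(univ.biUnion fun K => endpoints a b (comp K)) := by
        rw [← mul_sum, card_biUnion]
        intro K _ K' _ hne
        exact hdisj (Set.mem_univ K) (Set.mem_univ K') hne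
    _ ≤ (h + 1) * Fintype.card V := Nat.mul_le_mul_left _ (card_le_univ _)

theorem mul_card_edges_le_of_monoComponentsLE [Fintype V] [Fintype E] (a b : E → V) {t : ℕ}
    (c : E → Fin t) {s h : ℕ} (hc : MonoComponentsLE (lineGraphOf a b) c s)
    (hF : ∀ F : Finset E, #F ≤ s → h * #F ≤ (h + 1) * #(endpoints a b F)) :
    h * Fintype.card E ≤ t * ((h + 1) * Fintype.card V) := by
  rw [← card_univ, card_eq_sum_card_fiberwise (f := c) (t := univ) (fun _ _ => mem_univ _), mul_sum]
  refine (sum_le_sum fun i _ => mul_card_colorClass_le a b c hc hF i).trans ?_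
  simp

end LineGraph

/-! ### Relabelling edges and passing to edge subsets. -/

section HalfDegree

variable {V E E' : Type*} [DecidableEq V]

theorem halfDegree_comp_equiv (a b : E → V) (e : E' ≃ E) (F : Finset E') (v : V) :
    halfDegree (a ∘ e) (b ∘ e) F v = halfDegree a b (F.map e.toEmbedding) v := by
  simp [halfDegree, filter_map]

theorem endpoints_comp_equiv (a b : E → V) (e : E' ≃ E) (F : Finset E') :
    endpoints (a ∘ e) (b ∘ e) F = endpoints a b (F.map e.toEmbedding) := by
  classical
  simp only [endpoints, map_eq_image, image_image]
  rfl

theorem halfDegree_le_univ [Fintype E] (a b : E → V) (F : Finset E) (v : V) :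
    halfDegree a b F v ≤ halfDegree a b univ v :=
  add_le_add (card_le_card (filter_subset_filter _ (subset_univ _)))
    (card_le_card (filter_subset_filter _ (subset_univ _)))

/-- Full degree at `b e` forces `e ∈ F`. This carries nonzero degree from a vertex to its child
along an arm. -/
theorem one_le_halfDegree_of_halfDegree_univ_le [Fintype E] (a b : E → V) {F : Finset E} (e : E)
    (h : halfDegree a b univ (b e) ≤ halfDegree a b F (b e)) : 1 ≤ halfDegree a b F (a e) := by
  have h1 : #{f ∈ F | a f = b e} ≤ #{f | a f = b e} :=
    card_le_card (filter_subset_filter _ (subset_univ _))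
  have hsub : ({f ∈ F | b f = b e} : Finset E) ⊆ ({f | b f = b e} : Finset E) :=
    filter_subset_filter _ (subset_univ _)
  have h2 := eq_of_subset_of_card_le hsub (by simp only [halfDegree] at h; omega)
  have heF : e ∈ ({f ∈ F | b f = b e} : Finset E) := by rw [h2]; simp
  refine le_add_right (card_pos.2 ⟨e, ?_⟩)
  simpa using (mem_filter.1 heF).1

theorem card_endpoints_le (a b : E → V) (F : Finset E) : #(endpoints a b F) ≤ 2 * #F := by
  have h1 : #(F.image a) ≤ #F := card_image_le
  have h2 : #(F.image b) ≤ #F := card_image_le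
  have h3 := card_union_le (F.image a) (F.image b)
  simp only [endpoints]
  omega

theorem left_mem_endpoints (a b : E → V) {F : Finset E} {e : E} (he : e ∈ F) :
    a e ∈ endpoints a b F := mem_union_left _ (mem_image_of_mem _ he)

theorem right_mem_endpoints (a b : E → V) {F : Finset E} {e : E} (he : e ∈ F) :
    b e ∈ endpoints a b F := mem_union_right _ (mem_image_of_mem _ he)

end HalfDegree

/-! ### Excess along an arm. -/

section Excess

/-- The contribution of a vertex of degree `d` to the excess of the line graph over average
degree `2 * r`. -/
def excess (r : ℝ) (d : ℕ) : ℝ := (d : ℝ) * (d - 1) - r * d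

variable {r : ℝ}

theorem excess_nonpos (hr : 3 ≤ r) {d : ℕ} (hd : d ≤ 4) : excess r d ≤ 0 := by
  unfold excess
  interval_cases d <;> norm_num <;> linarith

theorem excess_le_neg_three (hr : 3 ≤ r) {d : ℕ} (h1 : 1 ≤ d) (hd : d ≤ 3) :
    excess r d ≤ -3 := by
  unfold excess
  interval_cases d <;> norm_num <;> linarith

/-- Walk down the arm. The first degree below 4 is still positive, so that vertex alone contributes
at most -3; if there is none, every vertex contributes exactly `-4(r - 3)`. -/
theorem sum_excess_le (hr : 3 ≤ r) (T : ℕ) (f : Fin (T + 1) → ℕ) (hf : ∀ t, f t ≤ 4)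
    (h0 : 1 ≤ f 0) (hs : ∀ t : Fin T, f t.castSucc = 4 → 1 ≤ f t.succ) :
    ∑ t, excess r (f t) ≤ -3 ∨ ∑ t, excess r (f t) ≤ -(4 * (r - 3) * (T + 1)) := by
  induction T with
  | zero =>
    rcases (hf 0).eq_or_lt with h | h
    · right; simp [h, excess]; linarith
    · left; simpa using excess_le_neg_three hr h0 (by omega)
  | succ T ih =>
    rw [Fin.sum_univ_succ]
    rcases (hf 0).eq_or_lt with h | h
    · have h4 : excess r (f 0) = -(4 * (r - 3)) := by rw [h, excess]; push_cast; ring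
      rw [h4]
      rcases ih (fun t => f t.succ) (fun t => hf _) (hs 0 h) (fun t ht => hs t.succ ht) with h' | h'
      · left; linarith
      · right; push_cast; linarith
    · left
      have h1 := excess_le_neg_three hr h0 (by omega)
      have h2 : ∑ t : Fin (T + 1), excess r (f t.succ) ≤ 0 :=
        sum_nonpos fun t _ => excess_nonpos hr (hf _)
      linarith

end Excess

/-! ### The tree blocks and their matching. -/

section Construction

variable {m T : ℕ}

/-- Non-root vertices of the tree block: four centres `(i, none)`, each with two arms. -/
abbrev BlockNode (T : ℕ) : Type := Fin 4 × Option (Bool × Fin (T + 1))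

/-- Half-edges (of either orientation) of a block. -/
abbrev BlockStub (T : ℕ) : Type := Fin 4 × Bool × Option (Fin (T + 1))

/-- Vertices of the multigraph: `m` copies of the tree block, with root `none`. -/
abbrev BlockVertex (m T : ℕ) : Type := Fin m × Option (BlockNode T)

/-- Edges of the multigraph: a tree edge below every non-root vertex, and the matched stubs. -/
abbrev BlockEdge (m T : ℕ) : Type := (Fin m × BlockNode T) ⊕ (Fin m × BlockStub T)

instance (m T : ℕ) : DecidableEq (BlockEdge m T) :=
  have : DecidableEq (Fin m × BlockNode T) := inferInstance
  have : DecidableEq (Fin m × BlockStub T) := inferInstance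
  instDecidableEqSum

/-- The parent of a non-root vertex of the tree block. -/
def parent : BlockNode T → Option (BlockNode T)
  | (_, none) => none
  | (i, some (s, t)) =>
    Fin.cases (some (i, none)) (fun t' : Fin T => some (i, some (s, t'.castSucc))) t

/-- The distance to the root of the tree block. -/
def depth : Option (BlockNode T) → ℕ
  | none => 0
  | some (_, none) => 1
  | some (_, some (_, t)) => t + 2

/-- The vertex carrying an outgoing stub. -/
def outNode : BlockStub T → BlockNode T
  | (i, _, none) => (i, none)
  | (i, s, some t) => (i, some (s, t))

/-- The vertex carrying an incoming stub. -/
def inNode : BlockStub T → BlockNode T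
  | (i, s, none) => (i, some (s, Fin.last T))
  | (i, s, some t) => (i, some (s, t))

/-- First endpoint of an edge. -/
def tail : BlockEdge m T → BlockVertex m T
  | .inl (j, x) => (j, some x)
  | .inr (j, x) => (j, some (outNode x))

/-- Second endpoint of an edge. -/
def head (π : Equiv.Perm (Fin m × BlockStub T)) : BlockEdge m T → BlockVertex m T
  | .inl (j, x) => (j, parent x)
  | .inr e => ((π e).1, some (inNode (π e).2))

@[simp] theorem parent_none (i : Fin 4) : parent (T := T) (i, none) = none := rfl

@[simp] theorem parent_zero (i : Fin 4) (s : Bool) :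
    parent (T := T) (i, some (s, 0)) = some (i, none) := rfl

@[simp] theorem parent_succ (i : Fin 4) (s : Bool) (t : Fin T) :
    parent (i, some (s, t.succ)) = some (i, some (s, t.castSucc)) := rfl

@[simp] theorem outNode_none (i : Fin 4) (s : Bool) :
    outNode (T := T) (i, s, none) = (i, none) := rfl

@[simp] theorem outNode_some (i : Fin 4) (s : Bool) (t : Fin (T + 1)) :
    outNode (i, s, some t) = (i, some (s, t)) := rfl

@[simp] theorem inNode_none (i : Fin 4) (s : Bool) :
    inNode (T := T) (i, s, none) = (i, some (s, Fin.last T)) := rfl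

@[simp] theorem inNode_some (i : Fin 4) (s : Bool) (t : Fin (T + 1)) :
    inNode (i, s, some t) = (i, some (s, t)) := rfl

@[simp] theorem tail_inl (j : Fin m) (x : BlockNode T) :
    tail (.inl (j, x)) = (j, some x) := rfl

@[simp] theorem tail_inr (j : Fin m) (x : BlockStub T) :
    tail (.inr (j, x)) = (j, some (outNode x)) := rfl

@[simp] theorem head_inl (π : Equiv.Perm (Fin m × BlockStub T)) (j : Fin m) (x : BlockNode T) :
    head π (.inl (j, x)) = (j, parent x) := rfl

@[simp] theorem head_inr (π : Equiv.Perm (Fin m × BlockStub T)) (e : Fin m × BlockStub T) :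
    head π (.inr e) = ((π e).1, some (inNode (π e).2)) := rfl

theorem depth_parent_lt (x : BlockNode T) : depth (parent x) < depth (some x) := by
  obtain ⟨i, _ | ⟨s, t⟩⟩ := x
  · simp [depth]
  · induction t using Fin.cases with
    | zero => simp [depth]
    | succ t => simp [depth]

variable (π : Equiv.Perm (Fin m × BlockStub T))

theorem halfDegree_root_le (j : Fin m) : halfDegree tail (head π) univ (j, none) ≤ 4 := by
  have h1 : ({e | tail e = (j, none)} : Finset (BlockEdge m T)) ⊆ (∅ : Finset (BlockEdge m T)) := by
    rintro (⟨j', x⟩ | ⟨j', x⟩) he <;> simp at he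
  have h2 : ({e | head π e = (j, none)} : Finset (BlockEdge m T)) ⊆
      ((univ : Finset (Fin 4)).image (fun i => .inl (j, (i, none))) : Finset (BlockEdge m T)) := by
    rintro (⟨j', i, _ | ⟨s, t⟩⟩ | e) he
    · simp_all
    · induction t using Fin.cases <;> simp at he
    · simp at he
  have h3 := card_le_card h1
  have h4 := (card_le_card h2).trans card_image_le
  rw [card_empty] at h3
  rw [card_univ, Fintype.card_fin] at h4
  simp only [halfDegree]
  omega

theorem halfDegree_center_le (j : Fin m) (i : Fin 4) :
    halfDegree tail (head π) univ (j, some (i, none)) ≤ 5 := by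
  have h1 : ({e | tail e = (j, some (i, none))} : Finset (BlockEdge m T)) ⊆
      ({.inl (j, (i, none)), .inr (j, (i, true, none)), .inr (j, (i, false, none))} : Finset (BlockEdge m T)) := by
    rintro (⟨j', i', _ | ⟨s, t⟩⟩ | ⟨j', i', s, _ | t⟩) he
    · simp_all
    · simp at he
    · cases s <;> simp_all
    · simp at he
  have h2 : ({e | head π e = (j, some (i, none))} : Finset (BlockEdge m T)) ⊆
      ({.inl (j, (i, some (true, 0))), .inl (j, (i, some (false, 0)))} : Finset (BlockEdge m T)) := by
    rintro (⟨j', i', _ | ⟨s, t⟩⟩ | e) he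
    · simp at he
    · induction t using Fin.cases
      · cases s <;> simp_all
      · simp at he
    · rcases hπ : π e with ⟨j', i', s, _ | t⟩ <;> simp [hπ] at he
  have h3 := (card_le_card h1).trans card_le_three
  have h4 := (card_le_card h2).trans card_le_two
  simp only [halfDegree]
  omega

/-- Each arm vertex has its parent edge, one outgoing stub and one incoming stub; the fourth place
is the child edge or, at the end of the arm, a second incoming stub. -/
theorem halfDegree_arm_le (j : Fin m) (i : Fin 4) (s : Bool) (t : Fin (T + 1)) :
    halfDegree tail (head π) univ (j, some (i, some (s, t))) ≤ 4 := by
  have h1 : ({e | tail e = (j, some (i, some (s, t)))} : Finset (BlockEdge m T)) ⊆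
      ({.inl (j, (i, some (s, t))), .inr (j, (i, s, some t))} : Finset (BlockEdge m T)) := by
    rintro (⟨j', i', _ | ⟨s', t'⟩⟩ | ⟨j', i', s', _ | t'⟩) he
    · simp at he
    · simp_all
    · simp at he
    · simp_all
  have h2 : ∃ x : BlockEdge m T, ({e | head π e = (j, some (i, some (s, t)))} :
      Finset (BlockEdge m T)) ⊆ ({.inr (π.symm (j, (i, s, some t))), x} : Finset (BlockEdge m T)) := by
    induction t using Fin.lastCases with
    | last =>
      refine ⟨.inr (π.symm (j, (i, s, none))), ?_⟩
      rintro (⟨j', i', _ | ⟨s', t'⟩⟩ | e) he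
      · simp at he
      · induction t' using Fin.cases
        · simp at he
        · simp [Fin.castSucc_ne_last] at he
      · rcases hπ : π e with ⟨j', i', s', _ | t'⟩ <;>
          simp_all [Equiv.eq_symm_apply]
    | cast t =>
      refine ⟨.inl (j, (i, some (s, t.succ))), ?_⟩
      rintro (⟨j', i', _ | ⟨s', t'⟩⟩ | e) he
      · simp at he
      · induction t' using Fin.cases
        · simp at he
        · simp_all
      · rcases hπ : π e with ⟨j', i', s', _ | t'⟩
        · simp [hπ, (Fin.castSucc_ne_last _).symm] at he
        · simp_all [Equiv.eq_symm_apply]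
  obtain ⟨x, h2⟩ := h2
  have h3 := (card_le_card h1).trans card_le_two
  have h4 := (card_le_card h2).trans card_le_two
  simp only [halfDegree]
  omega

theorem halfDegree_le_five (v : BlockVertex m T) : halfDegree tail (head π) univ v ≤ 5 := by
  rcases v with ⟨j, _ | ⟨i, _ | ⟨s, t⟩⟩⟩
  · exact (halfDegree_root_le π j).trans (by norm_num)
  · exact halfDegree_center_le π j i
  · exact (halfDegree_arm_le π j i s t).trans (by norm_num)

theorem halfDegree_tail_add_halfDegree_head_le (e : BlockEdge m T) :
    halfDegree tail (head π) univ (tail e) + halfDegree tail (head π) univ (head π e) ≤ 9 := by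
  rcases e with ⟨j, i, _ | ⟨s, t⟩⟩ | e
  · exact add_le_add (halfDegree_le_five π _) (halfDegree_root_le π j)
  · exact (add_le_add (halfDegree_arm_le π j i s t) (halfDegree_le_five π _)).trans (by norm_num)
  · refine (add_le_add (halfDegree_le_five π _) (?_ : _ ≤ 4)).trans (by norm_num)
    rcases hπ : π e with ⟨j', i', s', _ | t'⟩ <;> simp only [head, hπ] <;>
      exact halfDegree_arm_le π _ _ _ _

/-- Only a centre of degree 5 has positive excess, at most 5. Its two arms then start with positive
degree and contribute at most -3 each. -/
theorem sum_excess_halfDegree_nonpos {r : ℝ} (hr : 3 ≤ r) (hT : 3 ≤ 4 * (r - 3) * (T + 1))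
    (F : Finset (BlockEdge m T)) :
    ∑ v, excess r (halfDegree tail (head π) F v) ≤ 0 := by
  have harm : ∀ j i s t, halfDegree tail (head π) F (j, some (i, some (s, t))) ≤ 4 :=
    fun j i s t => (halfDegree_le_univ _ _ _ _).trans (halfDegree_arm_le π j i s t)
  rw [Fintype.sum_prod_type]
  refine sum_nonpos fun j _ => ?_
  rw [Fintype.sum_option]
  refine add_nonpos (excess_nonpos hr ((halfDegree_le_univ _ _ _ _).trans
    (halfDegree_root_le π j))) ?_
  rw [Fintype.sum_prod_type]
  refine sum_nonpos fun i _ => ?_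
  rw [Fintype.sum_option, Fintype.sum_prod_type, Fintype.sum_bool]
  set u := halfDegree tail (head π) F (j, some (i, none)) with hu
  have hu5 : u ≤ 5 := (halfDegree_le_univ _ _ _ _).trans (halfDegree_center_le π j i)
  rcases hu5.eq_or_lt with h5 | h5
  · have hS : ∀ s : Bool, ∑ t : Fin (T + 1),
        excess r (halfDegree tail (head π) F (j, some (i, some (s, t)))) ≤ -3 := by
      intro s
      refine (sum_excess_le hr T
        (fun t => halfDegree tail (head π) F (j, some (i, some (s, t))))
        (fun t => harm j i s t) ?_ ?_).elim id fun h => h.trans (by linarith)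
      · refine one_le_halfDegree_of_halfDegree_univ_le tail (head π)
          (.inl (j, (i, some (s, 0)))) ?_
        exact (halfDegree_center_le π j i).trans h5.ge
      · intro t ht
        refine one_le_halfDegree_of_halfDegree_univ_le tail (head π)
          (.inl (j, (i, some (s, t.succ)))) ?_
        exact (halfDegree_arm_le π j i s t.castSucc).trans ht.ge
    have h1 := hS true
    have h2 := hS false
    have h3 : excess r u ≤ 5 := by rw [h5, excess]; push_cast; linarith
    linarith
  · have hS : ∀ s : Bool, ∑ t : Fin (T + 1),
        excess r (halfDegree tail (head π) F (j, some (i, some (s, t)))) ≤ 0 :=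
      fun s => sum_nonpos fun t _ => excess_nonpos hr (harm j i s t)
    have h1 := hS true
    have h2 := hS false
    have h3 := excess_nonpos hr (d := u) (by omega)
    linarith

/-- The forest bound: charge each tree edge to its lower endpoint. In every touched block the
shallowest touched vertex stays uncharged, since its parent would be touched and shallower. -/
theorem card_toLeft_add_card_blocks_le (F : Finset (BlockEdge m T)) :
    #F.toLeft + #((endpoints tail (head π) F).image Prod.fst) ≤ #(endpoints tail (head π) F) := by
  classical
  set W := endpoints tail (head π) F with hW
  have hmin : ∀ j ∈ W.image Prod.fst, ∃ v ∈ W, v.1 = j ∧ ∀ w ∈ W, w.1 = j →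
      depth v.2 ≤ depth w.2 := by
    intro j hj
    obtain ⟨v, hv, rfl⟩ := mem_image.1 hj
    obtain ⟨w, hw, hmin⟩ := exists_min_image {w ∈ W | w.1 = v.1} (fun w => depth w.2)
      ⟨v, by simp [hv]⟩
    simp only [mem_filter] at hw hmin
    exact ⟨w, hw.1, hw.2, fun x hx hx' => hmin x ⟨hx, hx'⟩⟩
  choose! top hmem hfst hle using hmin
  have hinj : #((W.image Prod.fst).image top) = #(W.image Prod.fst) := by
    refine card_image_of_injOn fun j hj j' hj' h => ?_
    rw [← hfst j hj, ← hfst j' hj', h]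
  have hinj' : #(F.toLeft.image fun x => ((x.1, some x.2) : BlockVertex m T)) = #F.toLeft := by
    refine card_image_of_injective _ fun x y h => ?_
    simpa [Prod.ext_iff] using h
  rw [← hinj, ← hinj', ← card_union_of_disjoint]
  · refine card_le_card (union_subset ?_ ?_)
    · intro v hv
      obtain ⟨x, hx, rfl⟩ := mem_image.1 hv
      exact left_mem_endpoints tail (head π) (mem_toLeft.1 hx)
    · intro v hv
      obtain ⟨j, hj, rfl⟩ := mem_image.1 hv
      exact hmem j hj
  · refine Finset.disjoint_left.2 fun v hv hv' => ?_
    obtain ⟨x, hx, rfl⟩ := mem_image.1 hv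
    obtain ⟨j, hj, hjx⟩ := mem_image.1 hv'
    have h1 : (x.1, parent x.2) ∈ W := right_mem_endpoints tail (head π) (mem_toLeft.1 hx)
    have h2 := hle j hj _ h1 (by rw [← hfst j hj, hjx])
    rw [hjx] at h2
    exact absurd h2 (not_le.2 (depth_parent_lt x.2))

theorem mul_card_le_of_sparse {h : ℕ} (F : Finset (BlockEdge m T))
    (hπ : h * #{e : Fin m × BlockStub T | e.1 ∈ (endpoints tail (head π) F).image Prod.fst ∧
        (π e).1 ∈ (endpoints tail (head π) F).image Prod.fst}
      ≤ (h + 1) * #((endpoints tail (head π) F).image Prod.fst)) :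
    h * #F ≤ (h + 1) * #(endpoints tail (head π) F) := by
  have h1 := card_toLeft_add_card_blocks_le π F
  set W := endpoints tail (head π) F with hW
  have h2 : #F.toRight ≤
      #{e : Fin m × BlockStub T | e.1 ∈ W.image Prod.fst ∧ (π e).1 ∈ W.image Prod.fst} := by
    refine card_le_card fun e he => ?_
    rw [mem_toRight] at he
    simp only [mem_filter, mem_univ, true_and]
    exact ⟨mem_image.2 ⟨_, left_mem_endpoints tail (head π) he, rfl⟩,
      mem_image.2 ⟨_, right_mem_endpoints tail (head π) he, rfl⟩⟩
  have h3 := Nat.mul_le_mul_left h h2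
  have h4 : #(W.image Prod.fst) ≤ #W := card_image_le
  rw [← card_toLeft_add_card_toRight]
  nlinarith

end Construction

end MonoComp

/-! ### Choice of parameters and conclusion. -/

open MonoComp Finset in
theorem theorem2 (ε : ℝ) (hε : 0 < ε) :
    ∃ c : ℝ, 0 < c ∧ ∀ N : ℕ, ∃ n : ℕ, N ≤ n ∧
      ∃ (G : SimpleGraph (Fin n)) (_ : DecidableRel G.Adj),
        (∀ v : Fin n, G.degree v ≤ 7) ∧
        (∀ H : G.Subgraph, MonoComp.averageDegree H.coe ≤ 6 + ε) ∧
        c * (n : ℝ) ≤ (MonoComp.mcc 2 G : ℝ) := by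
  classical
  obtain ⟨T, hT⟩ := exists_nat_ge (3 / (2 * ε))
  set h := 8 * (T + 1) + 6 with hh
  set k := 16 * (T + 1) + 12 with hk
  obtain ⟨c, hc0, hc⟩ := exists_perm_sparse (BlockStub T) h (by omega)
  -- There are `k` line graph vertices per block, and `s` edges touch at most `2 * s` blocks; hence
  -- the factor `2 * k`.
  refine ⟨c / (2 * k), by positivity, fun N => ?_⟩
  obtain ⟨π, hπ⟩ := hc (N + 1) (by omega)
  have hV : Fintype.card (BlockVertex (N + 1) T) = (N + 1) * (8 * (T + 1) + 5) := by
    simp only [Fintype.card_prod, Fintype.card_fin, Fintype.card_option, Fintype.card_bool]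
    ring
  have hE : Fintype.card (BlockEdge (N + 1) T) = (N + 1) * k := by
    simp only [Fintype.card_prod, Fintype.card_fin, Fintype.card_option, Fintype.card_bool,
      Fintype.card_sum, hk]
    ring
  let e : Fin ((N + 1) * k) ≃ BlockEdge (N + 1) T := (Fintype.equivFinOfCardEq hE).symm
  refine ⟨(N + 1) * k, by nlinarith, lineGraphOf (tail ∘ e) (head π ∘ e), inferInstance, ?_, ?_, ?_⟩
  · intro v
    have h1 := degree_lineGraphOf_add_two_le (tail ∘ e) (head π ∘ e) v
    have h2 := halfDegree_tail_add_halfDegree_head_le π (e v)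
    simp only [halfDegree_comp_equiv, map_univ_equiv, Function.comp_apply] at h1
    omega
  · intro H
    have h1 := averageDegree_le_of_sum_halfDegree_le (tail ∘ e) (head π ∘ e) (r := 3 + ε / 2)
      (by positivity) H ?_
    · linarith
    · intro F
      simp only [halfDegree_comp_equiv]
      refine sum_excess_halfDegree_nonpos π (by linarith) ?_ _
      rw [div_le_iff₀ (by positivity)] at hT
      nlinarith
  · by_contra! hcon
    obtain ⟨col, hcol⟩ := exists_coloring_mcc 2 (by norm_num)
      (lineGraphOf (tail ∘ e) (head π ∘ e))
    have h1 := mul_card_edges_le_of_monoComponentsLE (tail ∘ e) (head π ∘ e) (h := h) col hcol ?_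
    · rw [Fintype.card_fin, hV] at h1
      have h2 : h * k ≤ 2 * ((h + 1) * (8 * (T + 1) + 5)) := by
        refine le_of_mul_le_mul_left (a := N + 1) ?_ (Nat.succ_pos N)
        calc (N + 1) * (h * k) = h * ((N + 1) * k) := by ring
          _ ≤ _ := h1
          _ = _ := by ring
      -- Since `k = 2h` and a block has `h - 1` vertices, `h2` reads `2h² ≤ 2(h² - 1)`.
      rw [hh, hk] at h2
      nlinarith
    · intro F hF
      rw [endpoints_comp_equiv, ← card_map e.toEmbedding]
      refine mul_card_le_of_sparse π _ (hπ _ ?_)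
      have h1 : #((endpoints tail (head π) (F.map e.toEmbedding)).image Prod.fst) ≤ 2 * #F := by
        refine card_image_le.trans ((card_endpoints_le _ _ _).trans ?_)
        rw [card_map]
      have h2 : (#((endpoints tail (head π) (F.map e.toEmbedding)).image Prod.fst) : ℝ)
          ≤ 2 * #F := by exact_mod_cast h1
      have h3 : (#F : ℝ) ≤ mcc 2 (lineGraphOf (tail ∘ e) (head π ∘ e)) := by exact_mod_cast hF
      have h4 : c / (2 * k) * (((N + 1) * k : ℕ) : ℝ) = c * ((N + 1 : ℕ) : ℝ) / 2 := by
        have : (k : ℝ) ≠ 0 := by positivity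
        push_cast
        field_simp
      linarith
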